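/- Let $A$ be a commutative Noetherian local ring, let $\operatorname{mod} A$ be the abelian category of finitely generated $A$-modules, and let $D^b_f(A)$ be the full subcategory of the derived category $D(\operatorname{mod} A)$ whose objects are those isomorphic to a bounded complex of finitely generated $A$-modules all of whose cohomology modules have finite length. Then: 1. $D^b_f(A)$ is a triangulated subcategory of $D(\operatorname{mod} A)$; in particular, with the inherited shift and distinguished triangles, it is a triangulated category. 2. $D^b_f(A)$ is Hom-finite: for all objects $X, Y$ of $D^b_f(A)$ the $A$-module $\operatorname{Hom}_{D^b_f(A)}(X,Y)$ has finite length. 3. Idempotents split in $D^b_f(A)$. 4. $D^b_f(A)$ is a Krull-Schmidt category: every object is isomorphic to a finite (possibly empty) direct sum of indecomposable objects, and the endomorphism ring of every indecomposable object is local. -/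

import Mathlib

open CategoryTheory CategoryTheory.Limits

universe w v u

/-- The objects of `D^b_f(A)`, as a property of objects of the derived category of the abelian
category `mod A` of finitely generated `A`-modules: those isomorphic to (the image of) a bounded
complex of finitely generated modules all of whose cohomology modules have finite length. -/
def boundedFiniteLength (A : Type u) [CommRing A] [IsNoetherianRing A]
    [HasDerivedCategory.{w} (FGModuleCat.{u} A)] :
    ObjectProperty (DerivedCategory (FGModuleCat.{u} A)) := fun X =>
  ∃ K : CochainComplex (FGModuleCat.{u} A) ℤ,
    (∃ a b : ℤ, ∀ i : ℤ, i < a ∨ b < i → IsZero (K.X i)) ∧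
    (∀ i : ℤ, IsFiniteLength A (K.homology i)) ∧
    Nonempty (X ≅ DerivedCategory.Q.obj K)

/-- The category `D^b_f(A)`: the full subcategory of the derived category of `mod A` on the
bounded complexes with finite length cohomology. -/
abbrev DbFiniteLength (A : Type u) [CommRing A] [IsNoetherianRing A]
    [HasDerivedCategory.{w} (FGModuleCat.{u} A)] :=
  (boundedFiniteLength.{w} A).FullSubcategory

/-- An `A`-linear category is Hom-finite if all its Hom-modules have finite length. -/
def IsHomFinite (A : Type u) [CommRing A] (C : Type v) [Category.{w} C] [Preadditive C]
    [Linear A C] : Prop :=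
  ∀ X Y : C, IsFiniteLength A (X ⟶ Y)

/-- A Krull-Schmidt category: an additive category in which every object is a finite direct sum
of indecomposable objects (the zero object being the empty sum), and the endomorphism ring of
every indecomposable object is local. -/
structure IsKrullSchmidt (C : Type v) [Category.{w} C] [Preadditive C]
    [HasFiniteBiproducts C] [HasBinaryBiproducts C] : Prop where
  exists_decomposition : ∀ X : C, ∃ (n : ℕ) (F : Fin n → C),
    (∀ i, Indecomposable (F i)) ∧ Nonempty (X ≅ ⨁ F)
  isLocalRing_end : ∀ X : C, Indecomposable X → IsLocalRing (End X)

/-! For the canonical t-structure, the objects in question are the bounded ones with finite length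
cohomology (`boundedFiniteLength_eq`); both conditions are triangulated, hence so is their
intersection. The rest is dévissage along truncation triangles (`bounded_induction`). Hom-modules
between bounded objects are finitely generated, by reduction to Ext of modules (`finite_ext`). If X
is a shifted module M of finite length, the annihilator of M also kills Hom(X, Y), which therefore
has finite length; long exact sequences give general X. Idempotents split on shifts of the abelian
heart, and splitting passes to the middle of a triangle (`exists_splitting₂`). Krull-Schmidt then
follows formally: decompositions terminate because the length of End drops, and Fitting's lemma
makes the endomorphism rings of indecomposables local. -/

/-! ### Modules of finite length and Fitting's lemma -/

theorem IsFiniteLength.of_exact {R M N P : Type*} [Ring R] [AddCommGroup M] [AddCommGroup N]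
    [AddCommGroup P] [Module R M] [Module R N] [Module R P] {f : M →ₗ[R] N} {g : N →ₗ[R] P}
    (h : Function.Exact f g) (hM : IsFiniteLength R M) (hP : IsFiniteLength R P) :
    IsFiniteLength R N := by
  rw [isFiniteLength_iff_isNoetherian_isArtinian] at *
  obtain ⟨_, _⟩ := hM
  obtain ⟨_, _⟩ := hP
  exact ⟨isNoetherian_of_range_eq_ker f g h.linearMap_ker_eq.symm,
    isArtinian_of_range_eq_ker f g h.linearMap_ker_eq.symm⟩

/-- A finitely generated module annihilated by the annihilator of a module of finite length has
finite length. -/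
theorem IsFiniteLength.of_annihilator_le {R M N : Type*} [CommRing R] [AddCommGroup M]
    [AddCommGroup N] [Module R M] [Module R N] (hM : IsFiniteLength R M) [Module.Finite R N]
    (h : Module.annihilator R M ≤ Module.annihilator R N) : IsFiniteLength R N := by
  have hM' := isFiniteLength_iff_isNoetherian_isArtinian.1 hM
  obtain ⟨_, _⟩ := hM'
  obtain ⟨m, s, hs⟩ := Module.Finite.exists_fin (R := R) (M := M)
  -- Evaluation on generators of M embeds R / ker φ into a finite power of M, so this ring has
  -- finite length; N is then a quotient of a finite power of it.
  let φ : R →ₗ[R] (Fin m → M) := LinearMap.pi fun i => LinearMap.toSpanSingleton R M (s i)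
  have hφ : LinearMap.ker φ ≤ Module.annihilator R N := by
    intro r hr
    apply h
    rw [← Submodule.annihilator_top, ← hs, Submodule.mem_annihilator_span]
    rintro ⟨_, i, rfl⟩
    exact congrFun hr i
  have hR : IsFiniteLength R (R ⧸ LinearMap.ker φ) := by
    have : IsFiniteLength R (Fin m → M) :=
      isFiniteLength_iff_isNoetherian_isArtinian.2 ⟨inferInstance, inferInstance⟩
    exact this.of_injective (f := (LinearMap.ker φ).liftQ φ le_rfl)
      (LinearMap.ker_eq_bot.1 (Submodule.ker_liftQ_eq_bot _ _ _ le_rfl))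
  obtain ⟨_, _⟩ := isFiniteLength_iff_isNoetherian_isArtinian.1 hR
  obtain ⟨n, t, ht⟩ := Module.Finite.exists_fin (R := R) (M := N)
  let ψ : (Fin n → R ⧸ LinearMap.ker φ) →ₗ[R] N :=
    LinearMap.lsum R _ R fun j => (LinearMap.ker φ).liftQ (LinearMap.toSpanSingleton R N (t j))
      fun r hr => Module.mem_annihilator.1 (hφ hr) (t j)
  have hψ : Function.Surjective ψ := by
    rw [← LinearMap.range_eq_top, ← top_le_iff, ← ht, Submodule.span_le]
    rintro _ ⟨j, rfl⟩
    refine ⟨Pi.single j (Submodule.Quotient.mk 1), ?_⟩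
    rw [LinearMap.lsum_piSingle]
    exact one_smul R (t j)
  have : IsFiniteLength R (Fin n → R ⧸ LinearMap.ker φ) :=
    isFiniteLength_iff_isNoetherian_isArtinian.2 ⟨inferInstance, inferInstance⟩
  exact this.of_surjective hψ

/-- Fitting's lemma for elements of an algebra of finite length. -/
theorem exists_isIdempotentElem_pow_eq_of_isArtinian {A E : Type*} [CommRing A] [Ring E]
    [Algebra A E] [IsArtinian A E] (f : E) :
    ∃ (n : ℕ) (e g : E), IsIdempotentElem e ∧ f ^ n * e = f ^ n ∧ f ^ (n + 1) * g = e ∧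
      Commute f g := by
  -- E need not be commutative, but the subalgebra generated by f is, and it is again Artinian.
  let S := Algebra.adjoin A {f}
  let _ : CommRing S := inferInstance
  have : IsArtinian A S := inferInstanceAs (IsArtinian A (Subalgebra.toSubmodule S))
  have : IsArtinianRing S := isArtinian_of_tower A this
  let x : S := ⟨f, Algebra.self_mem_adjoin_singleton A f⟩
  obtain ⟨n, y, hy⟩ := IsArtinian.exists_pow_succ_smul_dvd x (1 : S)
  have hy' : x ^ n = x ^ (n + 1) * y := by simpa using hy.symm
  have key : ∀ k, x ^ n = x ^ (n + k) * y ^ k := by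
    intro k
    induction k with
    | zero => simp
    | succ k ih =>
      calc x ^ n = x ^ k * x ^ n * y ^ k := by rw [← pow_add, add_comm k, ← ih]
        _ = x ^ (n + (k + 1)) * y ^ (k + 1) := by rw [hy']; ring
  -- The exponent n + 1 rather than n keeps a factor f in e even when n = 0, so that e = 1 makes f a
  -- unit.
  refine ⟨n, ((x ^ (n + 1) * y ^ (n + 1) : S) : E), ((y ^ (n + 1) : S) : E), ?_, ?_, rfl, ?_⟩
  · have h := key (n + 1)
    have : x ^ (n + 1) * y ^ (n + 1) * (x ^ (n + 1) * y ^ (n + 1)) =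
        x ^ (n + 1) * y ^ (n + 1) := by
      calc _ = x * (x ^ (n + (n + 1)) * y ^ (n + 1)) * y ^ (n + 1) := by ring
        _ = _ := by rw [← h]; ring
    exact congrArg Subtype.val this
  · have h := key (n + 1)
    have : x ^ n * (x ^ (n + 1) * y ^ (n + 1)) = x ^ n := by
      rw [← mul_assoc, ← pow_add, ← h]
    exact congrArg Subtype.val this
  · exact congrArg Subtype.val (mul_comm x (y ^ (n + 1)))

/-- A nonzero algebra of finite length without nontrivial idempotents is local. -/
theorem IsLocalRing.of_isArtinian_of_isIdempotentElem (A : Type*) {E : Type*} [CommRing A]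
    [Ring E] [Nontrivial E] [Algebra A E] [IsArtinian A E]
    (h : ∀ e : E, IsIdempotentElem e → e = 0 ∨ e = 1) : IsLocalRing E := by
  refine ⟨fun {a b} hab => ?_⟩
  obtain ⟨n, e, g, he, h₁, h₂, hc⟩ := exists_isIdempotentElem_pow_eq_of_isArtinian (A := A) a
  rcases h e he with rfl | rfl
  · right
    have : IsNilpotent a := ⟨n, by rw [← h₁, mul_zero]⟩
    rw [← eq_sub_iff_add_eq'] at hab
    rw [hab]
    exact this.isUnit_one_sub
  · left
    have h₃ : a * (a ^ n * g) = 1 := by rw [← mul_assoc, ← pow_succ', h₂]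
    refine ⟨⟨a, a ^ n * g, h₃, ?_⟩, rfl⟩
    rw [← h₃, ← ((Commute.refl a).pow_right n).mul_right hc |>.eq]

namespace CategoryTheory

/-! ### Krull-Schmidt from Hom-finiteness and split idempotents -/

section KrullSchmidt

variable {C : Type u} [Category.{v} C] [Preadditive C]

/-- An idempotent that splits along with its complement decomposes the object. -/
theorem exists_iso_biprod_of_idempotent [HasBinaryBiproducts C] [IsIdempotentComplete C] {X : C}
    (p : X ⟶ X) (hp : p ≫ p = p) :
    ∃ Y Z : C, Nonempty (X ≅ Y ⊞ Z) ∧ (IsZero Y → p = 0) ∧ (IsZero Z → p = 𝟙 X) := by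
  obtain ⟨Y, i, e, hie, hei⟩ := IsIdempotentComplete.idempotents_split X p hp
  obtain ⟨Z, j, f, hjf, hfj⟩ := IsIdempotentComplete.idempotents_split X (𝟙 X - p)
    (by simp [hp])
  have hif : i ≫ f = 0 := by
    calc i ≫ f = (i ≫ e) ≫ i ≫ f ≫ (j ≫ f) := by simp [hie, hjf]
      _ = i ≫ (e ≫ i) ≫ (f ≫ j) ≫ f := by simp only [Category.assoc]
      _ = 0 := by rw [hei, hfj, ← Category.assoc p]; simp [hp]
  have hje : j ≫ e = 0 := by
    calc j ≫ e = (j ≫ f) ≫ j ≫ e ≫ (i ≫ e) := by simp [hie, hjf]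
      _ = j ≫ (f ≫ j) ≫ (e ≫ i) ≫ e := by simp only [Category.assoc]
      _ = 0 := by rw [hei, hfj, ← Category.assoc _ p]; simp [hp]
  refine ⟨Y, Z, ⟨⟨biprod.lift e f, biprod.desc i j, by simp [hei, hfj], ?_⟩⟩, fun h => ?_,
    fun h => ?_⟩
  · ext <;> simp [hie, hif, hje, hjf]
  · rw [← hei, h.eq_of_src i 0, comp_zero]
  · rw [h.eq_of_src j 0, comp_zero] at hfj
    exact (sub_eq_zero.1 hfj.symm).symm

/-- The biproduct over a disjoint union is the binary biproduct of the biproducts. -/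
noncomputable def biprodBiproductIsoSum [HasBinaryBiproducts C] [HasFiniteBiproducts C]
    {ι κ : Type} [Finite ι] [Finite κ] (F : ι ⊕ κ → C) :
    (⨁ fun i => F (.inl i)) ⊞ (⨁ fun j => F (.inr j)) ≅ ⨁ F where
  hom := biprod.desc (biproduct.desc fun i => biproduct.ι F (.inl i))
    (biproduct.desc fun j => biproduct.ι F (.inr j))
  inv := biproduct.desc (Sum.rec
    (fun i => biproduct.ι (fun i => F (.inl i)) i ≫ biprod.inl)
    (fun j => biproduct.ι (fun j => F (.inr j)) j ≫ biprod.inr))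
  hom_inv_id := by
    apply biprod.hom_ext' <;> apply biproduct.hom_ext' <;> intro <;> simp
  inv_hom_id := by
    apply biproduct.hom_ext'
    rintro (i | j) <;> simp

theorem Linear.length_end_add_length_end_le (A : Type*) [CommRing A] [Linear A C]
    [HasBinaryBiproducts C] {X Y Z : C} (φ : X ≅ Y ⊞ Z) :
    Module.length A (Y ⟶ Y) + Module.length A (Z ⟶ Z) ≤ Module.length A (X ⟶ X) := by
  let L : (Y ⟶ Y) × (Z ⟶ Z) →ₗ[A] (X ⟶ X) :=
    { toFun f := φ.hom ≫ biprod.map f.1 f.2 ≫ φ.inv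
      map_add' f g := by
        rw [← Preadditive.comp_add, ← Preadditive.add_comp]
        congr 2
        ext <;> simp
      map_smul' a f := by
        simp only [RingHom.id_apply]
        rw [← Linear.comp_smul, ← Linear.smul_comp]
        congr 2
        ext <;> simp }
  have hL : Function.Injective L := by
    intro f g h
    have h' : biprod.map f.1 f.2 = biprod.map g.1 g.2 := by
      simpa [L, cancel_epi, cancel_mono] using h
    apply Prod.ext
    · simpa using congrArg (fun t => biprod.inl ≫ t ≫ biprod.fst) h'
    · simpa using congrArg (fun t => biprod.inr ≫ t ≫ biprod.snd) h'
  rw [← Module.length_prod]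
  exact Module.length_le_of_injective L hL

theorem Linear.length_end_pos (A : Type*) [CommRing A] [Linear A C] {X : C} (hX : ¬ IsZero X) :
    0 < Module.length A (X ⟶ X) := by
  rw [Module.length_pos_iff]
  exact ⟨𝟙 X, 0, fun h => hX ((IsZero.iff_id_eq_zero X).2 h)⟩

variable [HasFiniteBiproducts C] [HasBinaryBiproducts C]

/-- End Y × End Z embeds in End (Y ⊞ Z) and both factors are nonzero, so each summand has a strictly
shorter endomorphism module. -/
theorem exists_iso_biproduct_indecomposable (A : Type*) [CommRing A] [Linear A C]
    (h : ∀ X : C, IsFiniteLength A (X ⟶ X)) (n : ℕ) (X : C) (hn : Module.length A (X ⟶ X) ≤ n) :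
    ∃ (ι : Type) (_ : Finite ι) (F : ι → C), (∀ i, Indecomposable (F i)) ∧
      Nonempty (X ≅ ⨁ F) := by
  induction n using Nat.strong_induction_on generalizing X with
  | _ n ih =>
    by_cases hX : IsZero X
    · refine ⟨Empty, inferInstance, Empty.elim, fun i => i.elim, ⟨hX.iso ?_⟩⟩
      rw [IsZero.iff_id_eq_zero]
      exact biproduct.hom_ext _ _ fun i => i.elim
    by_cases hX' : Indecomposable X
    · exact ⟨Unit, inferInstance, fun _ => X, fun _ => hX',
        ⟨⟨biproduct.ι (fun _ : Unit => X) (), biproduct.π (fun _ : Unit => X) (), by simp,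
          by ext; simp⟩⟩⟩
    simp only [Indecomposable, not_and, not_forall, not_or] at hX'
    obtain ⟨Y, Z, φ, hY, hZ⟩ := hX' hX
    have hle := (Linear.length_end_add_length_end_le A φ).trans hn
    have hpY := Linear.length_end_pos A hY
    have hpZ := Linear.length_end_pos A hZ
    obtain ⟨a, ha⟩ := ENat.ne_top_iff_exists.1 (Module.length_ne_top_iff.2 (h Y))
    obtain ⟨b, hb⟩ := ENat.ne_top_iff_exists.1 (Module.length_ne_top_iff.2 (h Z))
    rw [← ha] at hpY hle
    rw [← hb] at hpZ hle
    norm_cast at hpY hpZ hle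
    obtain ⟨ι, _, F, hF, ⟨φF⟩⟩ := ih a (by lia) Y ha.symm.le
    obtain ⟨κ, _, G, hG, ⟨φG⟩⟩ := ih b (by lia) Z hb.symm.le
    exact ⟨ι ⊕ κ, inferInstance, Sum.elim F G, Sum.rec hF hG,
      ⟨φ ≪≫ biprod.mapIso φF φG ≪≫ biprodBiproductIsoSum (Sum.elim F G)⟩⟩

/-- A Hom-finite category with split idempotents is a Krull-Schmidt category. -/
theorem IsHomFinite.isKrullSchmidt (A : Type*) [CommRing A] [Linear A C]
    [IsIdempotentComplete C] (h : IsHomFinite A C) : IsKrullSchmidt C where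
  exists_decomposition X := by
    obtain ⟨n, hn⟩ := ENat.ne_top_iff_exists.1 (Module.length_ne_top_iff.2 (h X X))
    obtain ⟨ι, _, F, hF, ⟨φ⟩⟩ :=
      exists_iso_biproduct_indecomposable A (fun X => h X X) n X hn.symm.le
    obtain ⟨m, ⟨e⟩⟩ := Finite.exists_equiv_fin ι
    exact ⟨m, F ∘ e.symm, fun i => hF _,
      ⟨φ ≪≫ biproduct.whiskerEquiv e fun i => eqToIso (by simp)⟩⟩
  isLocalRing_end X hX := by
    have : Nontrivial (End X) :=
      ⟨𝟙 X, 0, fun h => hX.1 ((IsZero.iff_id_eq_zero X).2 h)⟩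
    have : IsArtinian A (End X) := (isFiniteLength_iff_isNoetherian_isArtinian.1 (h X X)).2
    refine IsLocalRing.of_isArtinian_of_isIdempotentElem A fun e he => ?_
    obtain ⟨Y, Z, ⟨φ⟩, hY, hZ⟩ := exists_iso_biprod_of_idempotent e he
    exact (hX.2 Y Z φ).imp hY hZ

end KrullSchmidt

/-! ### Splitting idempotents in triangulated categories -/

section Idempotents

variable {C : Type u} [Category.{v} C]

/-- The objects all of whose idempotent endomorphisms split. -/
def idempotentsSplit (C : Type u) [Category.{v} C] : ObjectProperty C := fun X =>
  ∀ p : X ⟶ X, p ≫ p = p → ∃ (Y : C) (i : Y ⟶ X) (e : X ⟶ Y), i ≫ e = 𝟙 Y ∧ e ≫ i = p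

instance : (idempotentsSplit C).IsClosedUnderIsomorphisms where
  of_iso {X X'} φ hX p hp := by
    obtain ⟨Y, i, e, hie, hei⟩ := hX (φ.hom ≫ p ≫ φ.inv) (by simp [reassoc_of% hp])
    exact ⟨Y, i ≫ φ.hom, φ.inv ≫ e, by simp [hie], by simp [reassoc_of% hei]⟩

/-- If two idempotents differ by an endomorphism of square zero and one of them splits, then so
does the other. -/
theorem exists_splitting_of_sub_comp_self_eq_zero [Preadditive C] {X Y : C} {p : X ⟶ X}
    (hp : p ≫ p = p) {i : Y ⟶ X} {e : X ⟶ Y} (hie : i ≫ e = 𝟙 Y)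
    (h : (p - e ≫ i) ≫ (p - e ≫ i) = 0) :
    ∃ (i' : Y ⟶ X) (e' : X ⟶ Y), i' ≫ e' = 𝟙 Y ∧ e' ≫ i' = p := by
  -- Sandwiching this relation between i and e, then between p and p, gives the two identities
  -- needed.
  have h' : p - p ≫ e ≫ i - e ≫ i ≫ p + e ≫ i = 0 := by
    rw [← h]
    simp only [Preadditive.comp_sub, Preadditive.sub_comp, Category.assoc, hp, reassoc_of% hie]
    abel
  have h₁ : i ≫ p ≫ e = 𝟙 Y := by
    have := congrArg (fun t => i ≫ t ≫ e) h'
    simp only [Preadditive.comp_neg, Preadditive.sub_comp, Preadditive.comp_add,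
      Preadditive.add_comp, Category.assoc, hie, reassoc_of% hie, Category.comp_id, sub_self,
      zero_sub, comp_zero, zero_comp] at this
    exact (neg_add_eq_zero.1 this)
  have h₂ : p ≫ e ≫ i ≫ p = p := by
    have := congrArg (fun t => p ≫ t ≫ p) h'
    simp only [Preadditive.comp_sub, Preadditive.sub_comp, Preadditive.add_comp,
      Category.assoc, hp, reassoc_of% hp, sub_add_cancel,
      comp_zero, zero_comp] at this
    exact (sub_eq_zero.1 this).symm
  exact ⟨i ≫ p, p ≫ e, by simp [reassoc_of% hp, h₁], by simp [h₂]⟩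

open Pretriangulated

variable [Preadditive C] [HasZeroObject C] [HasShift C ℤ]
  [∀ n : ℤ, (shiftFunctor C n).Additive] [Pretriangulated C]

/-- An idempotent endomorphism of a distinguished triangle splits on the middle object if it
splits on the two outer objects. -/
theorem Pretriangulated.exists_splitting₂ {T : Triangle C} (hT : T ∈ distTriang C) (p : T ⟶ T)
    (hp : p ≫ p = p) (h₁ : idempotentsSplit C T.obj₁) (h₃ : idempotentsSplit C T.obj₃) :
    ∃ (Y : C) (i : Y ⟶ T.obj₂) (e : T.obj₂ ⟶ Y), i ≫ e = 𝟙 Y ∧ e ≫ i = p.hom₂ := by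
  obtain ⟨Y₁, i₁, e₁, hie₁, hei₁⟩ := h₁ p.hom₁ (congrArg TriangleMorphism.hom₁ hp)
  obtain ⟨Y₃, i₃, e₃, hie₃, hei₃⟩ := h₃ p.hom₃ (congrArg TriangleMorphism.hom₃ hp)
  obtain ⟨Y₂, f, g, hS⟩ := distinguished_cocone_triangle₂ (i₃ ≫ T.mor₃ ≫ e₁⟦(1 : ℤ)⟧')
  let S := Triangle.mk f g (i₃ ≫ T.mor₃ ≫ e₁⟦(1 : ℤ)⟧')
  have comm : T.mor₃ ≫ p.hom₁⟦(1 : ℤ)⟧' = p.hom₃ ≫ T.mor₃ := p.comm₃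
  have hi : (i₃ ≫ T.mor₃ ≫ e₁⟦(1 : ℤ)⟧') ≫ i₁⟦(1 : ℤ)⟧' = i₃ ≫ T.mor₃ := by
    rw [Category.assoc, Category.assoc, ← Functor.map_comp, hei₁, comm, ← hei₃, Category.assoc,
      reassoc_of% hie₃]
  have he : T.mor₃ ≫ e₁⟦(1 : ℤ)⟧' = e₃ ≫ i₃ ≫ T.mor₃ ≫ e₁⟦(1 : ℤ)⟧' := by
    rw [reassoc_of% hei₃, ← reassoc_of% comm, ← Functor.map_comp, ← hei₁, Category.assoc, hie₁,
      Category.comp_id]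
  obtain ⟨i₂, hf, hg⟩ : ∃ i₂ : Y₂ ⟶ T.obj₂, f ≫ i₂ = i₁ ≫ T.mor₁ ∧ g ≫ i₃ = i₂ ≫ T.mor₂ :=
    complete_distinguished_triangle_morphism₂ S T hS hT i₁ i₃ hi
  obtain ⟨e₂, hf', hg'⟩ : ∃ e₂ : T.obj₂ ⟶ Y₂, T.mor₁ ≫ e₂ = e₁ ≫ f ∧ T.mor₂ ≫ e₃ = e₂ ≫ g :=
    complete_distinguished_triangle_morphism₂ T S hT hS e₁ e₃ he
  let i : S ⟶ T := { hom₁ := i₁, hom₂ := i₂, hom₃ := i₃, comm₁ := hf, comm₂ := hg, comm₃ := hi }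
  let e : T ⟶ S :=
    { hom₁ := e₁, hom₂ := e₂, hom₃ := e₃, comm₁ := hf', comm₂ := hg', comm₃ := he }
  -- The fill-ins i₂ and e₂ are not canonical, so i₂ ≫ e₂ is only an isomorphism; its inverse v
  -- corrects e₂.
  have hu : IsIso (i₂ ≫ e₂) := by
    have h₁ : IsIso (i ≫ e).hom₁ := by
      change IsIso (i₁ ≫ e₁)
      rw [hie₁]
      infer_instance
    have h₃ : IsIso (i ≫ e).hom₃ := by
      change IsIso (i₃ ≫ e₃)
      rw [hie₃]
      infer_instance
    exact isIso₂_of_isIso₁₃ (i ≫ e) hS hS h₁ h₃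
  obtain ⟨v, huv, hvu⟩ := hu.out
  rw [Category.assoc] at huv
  have hfv : f ≫ v = f := by
    calc f ≫ v = (f ≫ i₂) ≫ e₂ ≫ v := by rw [hf, Category.assoc, reassoc_of% hf',
          reassoc_of% hie₁]
      _ = f := by rw [Category.assoc, huv, Category.comp_id]
  have hvg : v ≫ g = g := by
    calc v ≫ g = v ≫ i₂ ≫ e₂ ≫ g := by rw [← hg', ← reassoc_of% hg, hie₃, Category.comp_id]
      _ = g := by rw [← Category.assoc i₂, ← Category.assoc v, hvu, Category.id_comp]
  have hp₂ : p.hom₂ ≫ p.hom₂ = p.hom₂ := congrArg TriangleMorphism.hom₂ hp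
  -- The difference of the two idempotents vanishes after `T.mor₁` and before `T.mor₂`. It thus
  -- factors through `T.mor₂` and has square zero.
  have hd₁ : T.mor₁ ≫ (p.hom₂ - (e₂ ≫ v) ≫ i₂) = 0 := by
    rw [Preadditive.comp_sub, sub_eq_zero, p.comm₁, Category.assoc, reassoc_of% hf',
      reassoc_of% hfv, hf, reassoc_of% hei₁]
  have hd₃ : (p.hom₂ - (e₂ ≫ v) ≫ i₂) ≫ T.mor₂ = 0 := by
    rw [Preadditive.sub_comp, sub_eq_zero, ← p.comm₂, Category.assoc, Category.assoc, ← hg,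
      reassoc_of% hvg, ← reassoc_of% hg', hei₃]
  obtain ⟨δ, hδ⟩ := Triangle.yoneda_exact₂ _ hT _ hd₁
  obtain ⟨i', e', h, h'⟩ := exists_splitting_of_sub_comp_self_eq_zero hp₂ (i := i₂)
    (e := e₂ ≫ v) huv (by nth_rw 2 [hδ]; rw [← Category.assoc, hd₃, zero_comp])
  exact ⟨Y₂, i', e', h, h'⟩

end Idempotents

/-! ### Dévissage along a t-structure -/

namespace Triangulated.TStructure

open Pretriangulated

variable {C : Type u} [Category.{v} C] [Preadditive C] [HasZeroObject C] [HasShift C ℤ]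
  [∀ n : ℤ, (shiftFunctor C n).Additive] [Pretriangulated C] [IsTriangulated C]

/-- Induction on the amplitude of a bounded object for a t-structure. -/
theorem bounded_induction (t : TStructure C) {P : C → Prop}
    (pure : ∀ (X : C) (n : ℤ), t.IsGE X n → t.IsLE X n → P X)
    (ext : ∀ (X : C) (n : ℤ), P ((t.truncLT n).obj X) → P ((t.truncGE n).obj X) → P X)
    {X : C} (hX : t.bounded X) : P X := by
  obtain ⟨⟨a, ha⟩, b, hb⟩ := hX
  obtain ⟨k, hk⟩ : ∃ k : ℕ, t.IsLE X (a + k) :=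
    ⟨(b - a).toNat, t.isLE_of_le X b (a + (b - a).toNat) (by lia)⟩
  clear hb
  induction k generalizing X with
  | zero => exact pure X a ha (by simpa using hk)
  | succ k ih =>
    refine ext X (a + (k + 1 : ℕ)) (ih inferInstance ?_)
      (pure _ (a + (k + 1 : ℕ)) inferInstance inferInstance)
    have : t.IsLE ((t.truncLT (a + (k + 1 : ℕ))).obj X) (a + (k + 1 : ℕ) - 1) := inferInstance
    convert this using 1
    push_cast
    ring

/-- Idempotents split on bounded objects if they split on the shifts of the heart. -/
theorem idempotentsSplit_of_bounded (t : TStructure C)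
    (h : ∀ (X : C) (n : ℤ), t.IsGE X n → t.IsLE X n → idempotentsSplit C X)
    {X : C} (hX : t.bounded X) : idempotentsSplit C X := by
  refine t.bounded_induction h (fun X n h₁ h₃ p hp => ?_) hX
  exact exists_splitting₂ (t.triangleLTGE_distinguished n X) ((t.triangleLTGE n).map p)
    (by rw [← Functor.map_comp, hp]) h₁ h₃

end Triangulated.TStructure

end CategoryTheory

/-! ### Finite length in the category of finitely generated modules -/

namespace FGModuleCat

theorem isFiniteLength_of_isZero {A : Type u} [CommRing A] {M : FGModuleCat.{u} A} (h : IsZero M) :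
    IsFiniteLength A M := by
  have : Subsingleton M := ⟨fun x y => by
    have := congrArg (fun f : M ⟶ M => f.hom.hom (x - y)) (h.eq_of_src (𝟙 M) 0)
    exact sub_eq_zero.1 this⟩
  exact .of_subsingleton

variable {A : Type u} [CommRing A] [IsNoetherianRing A]

theorem function_exact {S : ShortComplex (FGModuleCat.{u} A)} (hS : S.Exact) :
    Function.Exact S.f.hom.hom S.g.hom.hom :=
  (ShortComplex.ShortExact.moduleCat_exact_iff_function_exact _).1
    (hS.map (forget₂ (FGModuleCat.{u} A) (ModuleCat.{u} A)))

theorem injective_of_mono {M N : FGModuleCat.{u} A} (f : M ⟶ N) [Mono f] :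
    Function.Injective f.hom.hom :=
  (ModuleCat.mono_iff_injective _).1
    (inferInstanceAs (Mono ((forget₂ (FGModuleCat.{u} A) (ModuleCat.{u} A)).map f)))

theorem surjective_of_epi {M N : FGModuleCat.{u} A} (f : M ⟶ N) [Epi f] :
    Function.Surjective f.hom.hom :=
  (ModuleCat.epi_iff_surjective _).1
    (inferInstanceAs (Epi ((forget₂ (FGModuleCat.{u} A) (ModuleCat.{u} A)).map f)))

theorem epi_of_surjective {M N : FGModuleCat.{u} A} (f : M ⟶ N)
    (hf : Function.Surjective f.hom.hom) : Epi f :=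
  (forget₂ (FGModuleCat.{u} A) (ModuleCat.{u} A)).epi_of_epi_map
    ((ModuleCat.epi_iff_surjective _).2 hf)

theorem isFiniteLength_of_mono {M N : FGModuleCat.{u} A} (f : M ⟶ N) [Mono f]
    (h : IsFiniteLength A N) : IsFiniteLength A M :=
  h.of_injective (injective_of_mono f)

theorem isFiniteLength_of_epi {M N : FGModuleCat.{u} A} (f : M ⟶ N) [Epi f]
    (h : IsFiniteLength A M) : IsFiniteLength A N :=
  h.of_surjective (surjective_of_epi f)

theorem isFiniteLength_iff_of_iso {M N : FGModuleCat.{u} A} (e : M ≅ N) :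
    IsFiniteLength A M ↔ IsFiniteLength A N :=
  ⟨isFiniteLength_of_mono e.inv, isFiniteLength_of_mono e.hom⟩

end FGModuleCat

/-! ### Cohomological description of the subcategory and its idempotents -/

namespace DerivedCategory

open Pretriangulated TStructure ZeroObject

/-- With its companion for `mor₂`, this shows that truncations inherit finite length cohomology: in
each degree one outer term of the triangle has no cohomology. -/
theorem mono_homologyFunctor_map_mor₁ {C : Type u} [Category.{v} C] [Abelian C]
    [HasDerivedCategory.{w} C] {T : Triangle (DerivedCategory C)} (hT : T ∈ distTriang _) (n : ℤ)
    [T.obj₁.IsLE (n - 1)] [T.obj₃.IsGE n] (i : ℤ) : Mono ((homologyFunctor C i).map T.mor₁) := by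
  by_cases hi : i < n
  · exact (HomologySequence.exact₁ T hT (i - 1) i (by lia)).mono_g
      ((isZero_of_isGE T.obj₃ n (i - 1) (by lia)).eq_of_src _ _)
  · exact ⟨fun f g _ => (isZero_of_isLE T.obj₁ (n - 1) i (by lia)).eq_of_tgt _ _⟩

theorem epi_homologyFunctor_map_mor₂ {C : Type u} [Category.{v} C] [Abelian C]
    [HasDerivedCategory.{w} C] {T : Triangle (DerivedCategory C)} (hT : T ∈ distTriang _) (n : ℤ)
    [T.obj₁.IsLE (n - 1)] [T.obj₃.IsGE n] (i : ℤ) : Epi ((homologyFunctor C i).map T.mor₂) := by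
  by_cases hi : i < n
  · exact ⟨fun f g _ => (isZero_of_isGE T.obj₃ n i hi).eq_of_src _ _⟩
  · exact (HomologySequence.exact₃ T hT i (i + 1) rfl).epi_f
      ((isZero_of_isLE T.obj₁ (n - 1) (i + 1) (by lia)).eq_of_tgt _ _)

theorem idempotentsSplit_of_isGE_of_isLE {C : Type u} [Category.{v} C] [Abelian C]
    [HasDerivedCategory.{w} C] (X : DerivedCategory C) (n : ℤ) [X.IsGE n] [X.IsLE n] :
    idempotentsSplit _ X := by
  obtain ⟨M, ⟨φ⟩⟩ := exists_iso_singleFunctor_obj_of_isGE_of_isLE X n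
  refine (idempotentsSplit _).prop_of_iso φ.symm fun p hp => ?_
  obtain ⟨q, rfl⟩ := (singleFunctor C n).map_surjective p
  obtain ⟨Y, i, e, hie, hei⟩ := IsIdempotentComplete.idempotents_split M q
    ((singleFunctor C n).map_injective (by simpa using hp))
  exact ⟨(singleFunctor C n).obj Y, (singleFunctor C n).map i, (singleFunctor C n).map e,
    by rw [← Functor.map_comp, hie, CategoryTheory.Functor.map_id], by rw [← Functor.map_comp, hei]⟩

variable (A : Type u) [CommRing A] [IsNoetherianRing A] [HasDerivedCategory.{w} (FGModuleCat.{u} A)]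

/-- The objects of the derived category of `mod A` all of whose cohomology modules have finite
length. -/
def finiteLengthCohomology : ObjectProperty (DerivedCategory (FGModuleCat.{u} A)) := fun X =>
  ∀ i : ℤ, IsFiniteLength A ((homologyFunctor (FGModuleCat.{u} A) i).obj X)

instance : (finiteLengthCohomology.{w} A).IsClosedUnderIsomorphisms where
  of_iso φ h i :=
    (FGModuleCat.isFiniteLength_iff_of_iso ((homologyFunctor _ i).mapIso φ)).1 (h i)

instance : (finiteLengthCohomology.{w} A).IsTriangulated where
  exists_zero := ⟨0, isZero_zero _, fun i =>
    FGModuleCat.isFiniteLength_of_isZero ((homologyFunctor _ i).map_isZero (isZero_zero _))⟩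
  isStableUnderShiftBy n :=
    { le_shift X h i := (FGModuleCat.isFiniteLength_iff_of_iso
        (((homologyFunctor (FGModuleCat.{u} A) 0).shiftIso n i (n + i) rfl).app X)).2 (h (n + i)) }
  toIsTriangulatedClosed₂ := ObjectProperty.IsTriangulatedClosed₂.mk' fun T hT h₁ h₃ i =>
    (h₁ i).of_exact (FGModuleCat.function_exact (HomologySequence.exact₂ T hT i)) (h₃ i)

theorem boundedFiniteLength_eq :
    boundedFiniteLength.{w} A = t.bounded ⊓ finiteLengthCohomology.{w} A := by
  ext X
  constructor
  · rintro ⟨K, ⟨a, b, hK⟩, h, ⟨φ⟩⟩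
    have : K.IsStrictlyGE a := by
      rw [CochainComplex.isStrictlyGE_iff]
      exact fun i hi => hK i (.inl hi)
    have : K.IsStrictlyLE b := by
      rw [CochainComplex.isStrictlyLE_iff]
      exact fun i hi => hK i (.inr hi)
    refine (ObjectProperty.prop_iff_of_iso _ φ).2
      ⟨⟨⟨a, inferInstance⟩, ⟨b, inferInstance⟩⟩, fun i => ?_⟩
    exact (FGModuleCat.isFiniteLength_iff_of_iso ((homologyFunctorFactors _ i).app K)).2 (h i)
  · rintro ⟨⟨⟨a, _⟩, ⟨b, _⟩⟩, h⟩
    obtain ⟨K, _, _, ⟨φ⟩⟩ := exists_iso_Q_obj_of_isGE_of_isLE X a b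
    refine ⟨K, ⟨a, b, fun i hi => ?_⟩, fun i => ?_, ⟨φ⟩⟩
    · obtain hi | hi := hi
      · exact K.isZero_of_isStrictlyGE a i hi
      · exact K.isZero_of_isStrictlyLE b i hi
    · exact (FGModuleCat.isFiniteLength_iff_of_iso ((homologyFunctor _ i).mapIso φ ≪≫
        (homologyFunctorFactors _ i).app K)).1 (h i)

instance : (boundedFiniteLength.{w} A).IsClosedUnderIsomorphisms := by
  rw [boundedFiniteLength_eq]
  infer_instance

instance : (boundedFiniteLength.{w} A).IsTriangulated := by
  rw [boundedFiniteLength_eq]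
  infer_instance

variable {A}

/-- Splittings are constructed in the ambient derived category; cohomology of a retract is a
subobject, so they stay in the subcategory. -/
theorem boundedFiniteLength_of_retract {X Y : DerivedCategory (FGModuleCat.{u} A)} (i : Y ⟶ X)
    (e : X ⟶ Y) (h : i ≫ e = 𝟙 Y) (hX : boundedFiniteLength.{w} A X) :
    boundedFiniteLength.{w} A Y := by
  rw [boundedFiniteLength_eq] at hX ⊢
  obtain ⟨⟨⟨a, _⟩, ⟨b, _⟩⟩, hX⟩ := hX
  have hi (k : ℤ) : Mono ((homologyFunctor (FGModuleCat.{u} A) k).map i) := by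
    have : (homologyFunctor (FGModuleCat.{u} A) k).map i ≫ (homologyFunctor _ k).map e = 𝟙 _ := by
      rw [← Functor.map_comp, h, CategoryTheory.Functor.map_id]
    exact mono_of_mono_fac this
  refine ⟨⟨⟨a, ?_⟩, ⟨b, ?_⟩⟩, fun k => FGModuleCat.isFiniteLength_of_mono
    ((homologyFunctor _ k).map i) (hX k)⟩
  · exact (isGE_iff Y a).2 fun k hk =>
      IsZero.of_mono ((homologyFunctor _ k).map i) (isZero_of_isGE X a k hk)
  · exact (isLE_iff Y b).2 fun k hk =>
      IsZero.of_mono ((homologyFunctor _ k).map i) (isZero_of_isLE X b k hk)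

instance : IsIdempotentComplete (DbFiniteLength.{w} A) where
  idempotents_split X p hp := by
    have hX := (boundedFiniteLength_eq.{w} A).le _ X.property
    obtain ⟨Y, i, e, hie, hei⟩ := t.idempotentsSplit_of_bounded
      (fun Z n _ _ => idempotentsSplit_of_isGE_of_isLE Z n) hX.1 p.hom
      (congrArg InducedCategory.Hom.hom hp)
    exact ⟨⟨Y, boundedFiniteLength_of_retract i e hie X.property⟩, ObjectProperty.homMk i,
      ObjectProperty.homMk e, ObjectProperty.hom_ext _ hie, ObjectProperty.hom_ext _ hei⟩

/-- Induction on the amplitude of a bounded object with cohomology of finite length. -/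
theorem boundedFiniteLength_induction {P : DerivedCategory (FGModuleCat.{u} A) → Prop}
    (pure : ∀ (X : DerivedCategory (FGModuleCat.{u} A)) (M : FGModuleCat.{u} A) (n : ℤ),
      IsFiniteLength A M → (X ≅ (singleFunctor _ n).obj M) → P X)
    (ext : ∀ T ∈ distTriang (DerivedCategory (FGModuleCat.{u} A)),
      P T.obj₁ → P T.obj₃ → P T.obj₂)
    {X : DerivedCategory (FGModuleCat.{u} A)} (hX : boundedFiniteLength.{w} A X) : P X := by
  rw [boundedFiniteLength_eq] at hX
  refine t.bounded_induction (P := fun X => finiteLengthCohomology.{w} A X → P X)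
    (fun X n _ _ h => ?_) (fun X n h₁ h₃ h => ?_) hX.1 hX.2
  · obtain ⟨M, ⟨φ⟩⟩ := exists_iso_singleFunctor_obj_of_isGE_of_isLE X n
    exact pure X M n ((FGModuleCat.isFiniteLength_iff_of_iso ((homologyFunctor _ n).mapIso φ ≪≫
      (singleFunctorCompHomologyFunctorIso _ n).app M)).1 (h n)) φ
  · have hT := t.triangleLTGE_distinguished n X
    exact ext _ hT
      (h₁ fun i => @FGModuleCat.isFiniteLength_of_mono _ _ _ _ _ _
        (mono_homologyFunctor_map_mor₁ hT n i) (h i))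
      (h₃ fun i => @FGModuleCat.isFiniteLength_of_epi _ _ _ _ _ _
        (epi_homologyFunctor_map_mor₂ hT n i) (h i))

end DerivedCategory

theorem Module.Finite.of_function_exact {R M N P : Type*} [Ring R] [IsNoetherianRing R]
    [AddCommGroup M] [AddCommGroup N] [AddCommGroup P] [Module R M] [Module R N] [Module R P]
    {f : M →ₗ[R] N} {g : N →ₗ[R] P} (h : Function.Exact f g) (_ : Module.Finite R M)
    (_ : Module.Finite R P) : Module.Finite R N := by
  have := isNoetherian_of_range_eq_ker f g h.linearMap_ker_eq.symm
  infer_instance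

/-! ### Finite generation of Ext -/

namespace FGModuleCat

variable {A : Type u} [CommRing A] [IsNoetherianRing A]

theorem finite_hom (M N : FGModuleCat.{u} A) : Module.Finite A (M ⟶ N) := by
  obtain ⟨m, s, hs⟩ := Module.Finite.exists_fin (R := A) (M := M)
  let φ : (M ⟶ N) →ₗ[A] (Fin m → N) :=
    { toFun f i := f.hom.hom (s i)
      map_add' _ _ := rfl
      map_smul' _ _ := rfl }
  refine Module.Finite.of_injective φ fun f g h => ?_
  ext1
  exact LinearMap.ext_on_range hs (congrFun h)

instance : EnoughProjectives (FGModuleCat.{u} A) where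
  presentation M := by
    obtain ⟨m, s, hs⟩ := Module.Finite.exists_fin (R := A) (M := M)
    have : Projective (FGModuleCat.of A (Fin m → A)) :=
      ⟨fun {E X} f e _ => by
        obtain ⟨g, hg⟩ := Module.projective_lifting_property e.hom.hom f.hom.hom
          (surjective_of_epi e)
        exact ⟨FGModuleCat.ofHom g, by ext1; exact hg⟩⟩
    let π : FGModuleCat.of A (Fin m → A) ⟶ M :=
      FGModuleCat.ofHom (Fintype.linearCombination A s)
    have : Epi π := epi_of_surjective π (by
      rw [← LinearMap.range_eq_top, ← hs]
      exact Fintype.range_linearCombination A s)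
    exact ⟨⟨_, π⟩⟩

/-- Dimension shifting: for a projective cover term P → M with kernel K, Ext of P vanishes in
positive degree, so Ext^n(K, N) surjects onto Ext^(n+1)(M, N). -/
theorem finite_ext [HasExt.{w} (FGModuleCat.{u} A)] (M N : FGModuleCat.{u} A) (n : ℕ) :
    Module.Finite A (Abelian.Ext.{w} M N n) := by
  induction n generalizing M with
  | zero =>
    have := finite_hom M N
    exact Module.Finite.equiv (Abelian.Ext.linearEquiv₀ (R := A)).symm
  | succ n ih =>
    let S := ShortComplex.mk _ _ (kernel.condition (Projective.π M))
    have hS : S.ShortExact :=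
      { exact := ShortComplex.exact_of_f_is_kernel _ (kernelIsKernel S.g) }
    have := ih S.X₁
    exact Module.Finite.of_surjective
      (Abelian.Ext.precompOfLinear hS.extClass A N (add_comm 1 n)) fun x =>
        Abelian.Ext.contravariant_sequence_exact₃ hS N x
          (Abelian.Ext.eq_zero_of_projective _) (add_comm 1 n)

end FGModuleCat

section

open Pretriangulated

variable {C : Type u} [Category.{v} C] [Preadditive C] [HasZeroObject C] [HasShift C ℤ]
  [∀ n : ℤ, (shiftFunctor C n).Additive] [Pretriangulated C] (R : Type*) [Ring R] [Linear R C]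
  {T : Triangle C}

theorem CategoryTheory.Pretriangulated.exact_leftComp
    (hT : T ∈ distTriang C) (Y : C) :
    Function.Exact (Linear.leftComp R Y T.mor₂) (Linear.leftComp R Y T.mor₁) := fun f =>
  ⟨fun hf => let ⟨g, hg⟩ := Triangle.yoneda_exact₂ T hT f hf; ⟨g, hg.symm⟩, fun ⟨g, hg⟩ => by
    rw [← hg]
    simp [comp_distTriang_mor_zero₁₂_assoc T hT]⟩

theorem CategoryTheory.Pretriangulated.exact_rightComp
    (hT : T ∈ distTriang C) (X : C) :
    Function.Exact (Linear.rightComp R X T.mor₁) (Linear.rightComp R X T.mor₂) := fun f =>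
  ⟨fun hf => let ⟨g, hg⟩ := Triangle.coyoneda_exact₂ T hT f hf; ⟨g, hg.symm⟩, fun ⟨g, hg⟩ => by
    rw [← hg]
    simp [comp_distTriang_mor_zero₁₂ T hT]⟩

end

/-! ### Hom-finiteness and the conclusion -/

namespace DerivedCategory

open Pretriangulated TStructure

variable {A : Type u} [CommRing A] [IsNoetherianRing A] [HasDerivedCategory.{w} (FGModuleCat.{u} A)]

theorem finite_hom_singleFunctor (M N : FGModuleCat.{u} A) (m n : ℤ) :
    Module.Finite A ((singleFunctor _ m).obj M ⟶ (singleFunctor _ n).obj N) := by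
  obtain h | h := lt_or_ge m n
  · have : Subsingleton ((singleFunctor _ m).obj M ⟶ (singleFunctor _ n).obj N) :=
      subsingleton_of_forall_eq 0 fun f => t.zero f m n h
    infer_instance
  · obtain ⟨k, rfl⟩ := Int.le.dest h
    have := hasExt_of_hasDerivedCategory (FGModuleCat.{u} A)
    have := FGModuleCat.finite_ext M N k
    -- Shifting by m = n + k puts M in degree 0 and N in degree -k, which turns the Hom-module into
    -- Ext^k(M, N).
    let F := shiftFunctor (DerivedCategory (FGModuleCat.{u} A)) (n + k)
    let φ : (F.obj ((singleFunctor _ (n + k)).obj M) ⟶ F.obj ((singleFunctor _ n).obj N)) ≃ₗ[A]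
        ((singleFunctor _ 0).obj M ⟶ ((singleFunctor _ 0).obj N)⟦(k : ℤ)⟧) :=
      Linear.homCongr A (((singleFunctors _).shiftIso (n + k) 0 (n + k) (by lia)).app M)
        (((singleFunctors _).shiftIso (n + k) (-k) n (by lia)).app N ≪≫
          (((singleFunctors _).shiftIso k (-k) 0 (by lia)).app N).symm)
    have : Module.Finite A
        ((singleFunctor _ 0).obj M ⟶ ((singleFunctor _ 0).obj N)⟦(k : ℤ)⟧) :=
      Module.Finite.equiv (Abelian.Ext.homLinearEquiv (R := A) (X := M) (Y := N) (n := k))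
    exact Module.Finite.of_injective (φ.toLinearMap ∘ₗ F.mapLinearMap A)
      (φ.injective.comp F.map_injective)

theorem finite_hom {X Y : DerivedCategory (FGModuleCat.{u} A)}
    (hX : (t : Triangulated.TStructure (DerivedCategory (FGModuleCat.{u} A))).bounded X)
    (hY : (t : Triangulated.TStructure (DerivedCategory (FGModuleCat.{u} A))).bounded Y) :
    Module.Finite A (X ⟶ Y) := by
  refine t.bounded_induction (P := fun X => Module.Finite A (X ⟶ Y))
    (fun X m _ _ => ?_) (fun X m h₁ h₃ => ?_) hX
  · refine t.bounded_induction (P := fun Y => Module.Finite A (X ⟶ Y))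
      (fun Y n _ _ => ?_) (fun Y n h₁ h₃ => ?_) hY
    · obtain ⟨M, ⟨φ⟩⟩ := exists_iso_singleFunctor_obj_of_isGE_of_isLE X m
      obtain ⟨N, ⟨ψ⟩⟩ := exists_iso_singleFunctor_obj_of_isGE_of_isLE Y n
      have := finite_hom_singleFunctor M N m n
      exact Module.Finite.equiv (Linear.homCongr A φ ψ).symm
    · exact .of_function_exact
        (exact_rightComp A (t.triangleLTGE_distinguished n Y) X) h₁ h₃
  · exact .of_function_exact (exact_leftComp A (t.triangleLTGE_distinguished m X) Y) h₃ h₁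

theorem isFiniteLength_hom {X Y : DerivedCategory (FGModuleCat.{u} A)}
    (hX : boundedFiniteLength.{w} A X)
    (hY : (t : Triangulated.TStructure (DerivedCategory (FGModuleCat.{u} A))).bounded Y) :
    IsFiniteLength A (X ⟶ Y) := by
  refine boundedFiniteLength_induction (P := fun X => IsFiniteLength A (X ⟶ Y))
    (fun X M n hM φ => ?_) (fun T hT h₁ h₃ => ?_) hX
  · have : t.IsGE X n := t.isGE_of_iso φ.symm n
    have : t.IsLE X n := t.isLE_of_iso φ.symm n
    have : Module.Finite A (X ⟶ Y) := finite_hom ⟨⟨n, inferInstance⟩, ⟨n, inferInstance⟩⟩ hY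
    -- A scalar killing M is zero on the identity of X, hence on every morphism out of X.
    refine hM.of_annihilator_le fun a ha => Module.mem_annihilator.2 fun f => ?_
    have h : a • 𝟙 M = 0 := by
      ext x
      exact Module.mem_annihilator.1 ha x
    have h' : a • 𝟙 ((singleFunctor _ n).obj M) = 0 := by
      rw [← CategoryTheory.Functor.map_id, ← Functor.map_smul, h, Functor.map_zero]
    calc a • f = φ.hom ≫ (a • 𝟙 ((singleFunctor _ n).obj M)) ≫ φ.inv ≫ f := by simp
      _ = 0 := by rw [h', zero_comp, comp_zero]
  · exact h₃.of_exact (exact_leftComp A hT Y) h₁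

theorem isHomFinite_DbFiniteLength : IsHomFinite A (DbFiniteLength.{w} A) := fun X Y =>
  (InducedCategory.homLinearEquiv (R := A) (X := X) (Y := Y)).symm.isFiniteLength
    (isFiniteLength_hom X.property ((boundedFiniteLength_eq.{w} A).le _ Y.property).1)

end DerivedCategory

theorem mainTheorem7 (A : Type u) [CommRing A] [IsNoetherianRing A] [IsLocalRing A]
    [HasDerivedCategory.{w} (FGModuleCat.{u} A)] :
    ∃ _ : (boundedFiniteLength.{w} A).IsTriangulated,
      IsTriangulated (DbFiniteLength.{w} A) ∧
      IsHomFinite A (DbFiniteLength.{w} A) ∧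
      IsIdempotentComplete (DbFiniteLength.{w} A) ∧
      IsKrullSchmidt (DbFiniteLength.{w} A) :=
  ⟨inferInstance, inferInstance, DerivedCategory.isHomFinite_DbFiniteLength, inferInstance,
    IsHomFinite.isKrullSchmidt A DerivedCategory.isHomFinite_DbFiniteLength⟩
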